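/- Let $\mathbb{k}$ be $\mathbb{R}$ or $\mathbb{C}$ and let $\Omega$ be a (small) Boolean algebra. A *precosheaf* $\mu$ on $\Omega$ is a functor from the poset $\Omega$ to the category of Banach spaces over $\mathbb{k}$ and linear contractions. A morphism $\tau\colon\mu\to\nu$ of precosheaves is a natural family of bounded linear maps $\tau_E\colon\mu(E)\to\nu(E)$ with $\|\tau\|:=\sup_E\|\tau_E\|<\infty$. A finite partition of $E\in\Omega$ is a finite set of nonzero pairwise disjoint elements with supremum $E$. For a finite partition $\mathcal{E}$ of $E$, let $\sum_{F\in\mathcal{E}}\mu(F)$ be the $\ell_1$-direct sum and let $\varepsilon_{\mathcal{E}}\colon\sum_{F\in\mathcal{E}}\mu(F)\to\mu(E)$ be the map whose components are the structure maps $\mu(F)\to\mu(E)$. A *cosheaf* is a precosheaf for which $\varepsilon_{\mathcal{E}}$ is an isometric isomorphism for every $E$ and every finite partition $\mathcal{E}$ of $E$. Cosheaves form a full subcategory of the category of precosheaves; let $i$ denote the inclusion. For a precosheaf $\mu$ and $E\in\Omega$ put $$\hat\mu(E)=\lim_{\mathcal{E}}\ \sum_{F\in\mathcal{E}}\mu(F),$$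 where $\mathcal{E}$ runs over the finite partitions of $E$ ordered by refinement: if $\mathcal{E}$ refines $\mathcal{F}$, the transition map $\sum_{G\in\mathcal{E}}\mu(G)\to\sum_{F\in\mathcal{F}}\mu(F)$ sends the summand $\mu(G)$ to the summand $\mu(F)$ with $G\le F$ by the structure map. Concretely, $\hat\mu(E)$ is the Banach space of compatible families $\theta=(\theta_{\mathcal{E}})_{\mathcal{E}}$ with $\|\theta\|=\sup_{\mathcal{E}}\|\theta_{\mathcal{E}}\|<\infty$, and this is a limit in the category of Banach spaces and linear contractions. For $E\le E'$, the structure map $\hat\mu(E)\to\hat\mu(E')$ sends $\theta$ to the family whose component at a partition $\mathcal{E}'$ of $E'$ is the image of $\theta_{\mathcal{E}'|E}$ in $\sum_{F\in\mathcal{E}'}\mu(F)$, where $\mathcal{E}'|E=\{F\wedge E: F\in\mathcal{E}',\,F\wedge E\neq 0\}$. On morphisms, $\hat\tau$ is induced componentwise by $\tau$. **Theorem.** The assignment $\mu\mapsto\hat\mu$ is a functor, linear and contractive on spaces of morphisms. Each $\hat\mu$ is a cosheaf, and $\mu\mapsto\hat\mu$ is right adjoint to the inclusion $i$ of cosheaves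 into precosheaves. The counit $\varepsilon_E\colon\hat\mu(E)\to\mu(E)$ is $\theta\mapsto\varepsilon_{\mathcal{E}}(\theta_{\mathcal{E}})$ (for any finite partition $\mathcal{E}$ of $E$), and the natural bijections $$\mathrm{Hom}(i\nu,\mu)\cong\mathrm{Hom}(\nu,\hat\mu)$$ are isometric linear isomorphisms. -/

import Mathlib

open CategoryTheory
open scoped ENNReal

universe v u

namespace Cosheafification

noncomputable section

/-! ### The category of Banach spaces and linear contractions -/

/-- A Banach space over `𝕜`, bundled. -/
structure Banc (𝕜 : Type v) [RCLike 𝕜] : Type (max v (u + 1)) where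
  /-- the underlying type -/
  carrier : Type u
  [normedAddCommGroup : NormedAddCommGroup carrier]
  [normedSpace : NormedSpace 𝕜 carrier]
  [completeSpace : CompleteSpace carrier]

attribute [instance] Banc.normedAddCommGroup Banc.normedSpace Banc.completeSpace

instance (𝕜 : Type v) [RCLike 𝕜] : CoeSort (Banc.{v, u} 𝕜) (Type u) := ⟨Banc.carrier⟩

/-- Linear contractions between Banach spaces: bounded linear maps of operator norm `≤ 1`. -/
@[ext]
structure Banc.Hom {𝕜 : Type v} [RCLike 𝕜] (A B : Banc.{v, u} 𝕜) where
  /-- the underlying bounded linear map -/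
  clm : A →L[𝕜] B
  norm_le : ‖clm‖ ≤ 1

instance (𝕜 : Type v) [RCLike 𝕜] : Category.{u} (Banc.{v, u} 𝕜) where
  Hom A B := Banc.Hom A B
  id A := ⟨ContinuousLinearMap.id 𝕜 A, ContinuousLinearMap.norm_id_le⟩
  comp f g := ⟨g.clm.comp f.clm, (ContinuousLinearMap.opNorm_comp_le _ _).trans
    (mul_le_one₀ g.norm_le (norm_nonneg _) f.norm_le)⟩

/-! ### Precosheaves and bounded natural transformations -/

/-- A precosheaf of Banach spaces on the Boolean algebra `Ω`: a contractive functor `Ω → Ban`,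
that is, a functor from the poset `Ω` all of whose structure maps are linear contractions. -/
structure Precosheaf (𝕜 : Type v) [RCLike 𝕜] (Ω : Type u) [BooleanAlgebra Ω] where
  /-- the underlying functor -/
  functor : Ω ⥤ Banc.{v, u} 𝕜

variable {𝕜 : Type v} [RCLike 𝕜] {Ω : Type u} [BooleanAlgebra Ω]

namespace Precosheaf

/-- The Banach space `μ(E)`. -/
abbrev obj (μ : Precosheaf 𝕜 Ω) (E : Ω) : Banc.{v, u} 𝕜 := μ.functor.obj E

/-- The structure map `μ(E) → μ(F)` for `E ≤ F`. -/
def ext (μ : Precosheaf 𝕜 Ω) {E F : Ω} (h : E ≤ F) : μ.obj E →L[𝕜] μ.obj F :=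
  (μ.functor.map (homOfLE h)).clm

theorem norm_ext_apply_le (μ : Precosheaf 𝕜 Ω) {E F : Ω} (h : E ≤ F) (x : μ.obj E) :
    ‖μ.ext h x‖ ≤ ‖x‖ := by
  simpa using (μ.ext h).le_of_opNorm_le (μ.functor.map (homOfLE h)).norm_le x

theorem ext_self (μ : Precosheaf 𝕜 Ω) {E : Ω} (h : E ≤ E) (x : μ.obj E) : μ.ext h x = x :=
  congrArg (fun f : Banc.Hom (μ.obj E) (μ.obj E) => f.clm x) (μ.functor.map_id E)

theorem ext_ext (μ : Precosheaf 𝕜 Ω) {E F G : Ω} (h : E ≤ F) (h' : F ≤ G) (x : μ.obj E) :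
    μ.ext h' (μ.ext h x) = μ.ext (h.trans h') x :=
  (congrArg (fun f : Banc.Hom (μ.obj E) (μ.obj G) => f.clm x)
    (μ.functor.map_comp (homOfLE h) (homOfLE h'))).symm

/-- The space of bounded natural transformations `μ → ν`: uniformly bounded families of bounded
linear maps `τ E : μ(E) → ν(E)`, natural in `E`, with the norm `sup_E ‖τ E‖`. -/
def natTrans (μ ν : Precosheaf 𝕜 Ω) :
    Submodule 𝕜 (lp (fun E : Ω => μ.obj E →L[𝕜] ν.obj E) ∞) where
  carrier := {τ | ∀ (E F : Ω) (h : E ≤ F) (x : μ.obj E), τ F (μ.ext h x) = ν.ext h (τ E x)}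
  zero_mem' := fun E F h x => by simp
  add_mem' := fun {a b} ha hb E F h x => by simp [ha E F h x, hb E F h x]
  smul_mem' := fun c a ha E F h x => by simp [ha E F h x]

theorem natTrans.ext_iff' {μ ν : Precosheaf 𝕜 Ω} {σ τ : natTrans μ ν}
    (h : ∀ E x, σ.1 E x = τ.1 E x) : σ = τ :=
  Subtype.ext (lp.ext (funext fun E => ContinuousLinearMap.ext (h E)))

theorem natTrans.norm_apply_le {μ ν : Precosheaf 𝕜 Ω} (τ : natTrans μ ν) (E : Ω) (x : μ.obj E) :
    ‖τ.1 E x‖ ≤ ‖τ‖ * ‖x‖ :=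
  (τ.1 E).le_of_opNorm_le (lp.norm_apply_le_norm ENNReal.top_ne_zero τ.1 E) x

/-- Build a bounded natural transformation from its components and a bound. -/
def natTrans.mk' {μ ν : Precosheaf 𝕜 Ω} (t : ∀ E : Ω, μ.obj E →L[𝕜] ν.obj E) (C : ℝ)
    (hC : ∀ E, ‖t E‖ ≤ C)
    (nat : ∀ (E F : Ω) (h : E ≤ F) (x : μ.obj E), t F (μ.ext h x) = ν.ext h (t E x)) :
    natTrans μ ν :=
  ⟨⟨t, memℓp_infty ⟨C, by rintro _ ⟨E, rfl⟩; exact hC E⟩⟩, nat⟩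

/-- The category of precosheaves and bounded natural transformations. -/
instance : Category.{u} (Precosheaf 𝕜 Ω) where
  Hom μ ν := natTrans μ ν
  id μ := natTrans.mk' (fun E => ContinuousLinearMap.id 𝕜 (μ.obj E)) 1
    (fun _ => ContinuousLinearMap.norm_id_le) (fun _ _ _ _ => rfl)
  comp {μ ν θ} σ τ := natTrans.mk' (fun E => (τ.1 E).comp (σ.1 E)) (‖τ‖ * ‖σ‖)
    (fun E => (ContinuousLinearMap.opNorm_comp_le _ _).trans (mul_le_mul
      (lp.norm_apply_le_norm ENNReal.top_ne_zero τ.1 E)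
      (lp.norm_apply_le_norm ENNReal.top_ne_zero σ.1 E) (norm_nonneg _) (norm_nonneg _)))
    (fun E F h x => by
      simp only [ContinuousLinearMap.comp_apply, σ.2 E F h x, τ.2 E F h])

instance (μ ν : Precosheaf 𝕜 Ω) : NormedAddCommGroup (μ ⟶ ν) :=
  inferInstanceAs (NormedAddCommGroup (natTrans μ ν))

instance (μ ν : Precosheaf 𝕜 Ω) : NormedSpace 𝕜 (μ ⟶ ν) :=
  inferInstanceAs (NormedSpace 𝕜 (natTrans μ ν))

/-- The component `μ(E) → ν(E)` of a morphism of precosheaves. -/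
def app {μ ν : Precosheaf 𝕜 Ω} (τ : μ ⟶ ν) (E : Ω) : μ.obj E →L[𝕜] ν.obj E :=
  (show natTrans μ ν from τ).1 E

theorem hom_ext {μ ν : Precosheaf 𝕜 Ω} {σ τ : μ ⟶ ν} (h : ∀ E x, app σ E x = app τ E x) :
    σ = τ :=
  natTrans.ext_iff' h

theorem norm_app_apply_le {μ ν : Precosheaf 𝕜 Ω} (τ : μ ⟶ ν) (E : Ω) (x : μ.obj E) :
    ‖app τ E x‖ ≤ ‖τ‖ * ‖x‖ :=
  natTrans.norm_apply_le τ E x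

theorem app_ext {μ ν : Precosheaf 𝕜 Ω} (τ : μ ⟶ ν) {E F : Ω} (h : E ≤ F) (x : μ.obj E) :
    app τ F (μ.ext h x) = ν.ext h (app τ E x) :=
  (show natTrans μ ν from τ).2 E F h x

/-! ### Coproducts over partitions and cosheaves -/

/-- The `ℓ¹`-coproduct `∑_{F ∈ P} μ(F)` over a finite partition `P` of `E`. -/
abbrev sumOver (μ : Precosheaf 𝕜 Ω) {E : Ω} (P : Finpartition E) : Type u :=
  PiLp 1 (fun F : P.parts => μ.obj F.1)

/-- The canonical map `ε_P : ∑_{F ∈ P} μ(F) → μ(E)`, with components the structure maps. -/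
def sumMap (μ : Precosheaf 𝕜 Ω) {E : Ω} (P : Finpartition E) (x : μ.sumOver P) : μ.obj E :=
  ∑ F : P.parts, μ.ext (P.le F.2) (x F)

/-- Cosheaves (for the finite topology), that is, finitely additive precosheaves: for every finite
partition `P` of every `E`, the canonical map `∑_{F ∈ P} μ(F) → μ(E)` is an isometric
isomorphism. -/
def IsCosheaf : ObjectProperty (Precosheaf 𝕜 Ω) := fun μ =>
  ∀ (E : Ω) (P : Finpartition E), Function.Bijective (μ.sumMap P) ∧
    ∀ x : μ.sumOver P, ‖μ.sumMap P x‖ = ‖x‖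

/-! ### Transition maps between coproducts -/

/-- Every part of `P` lies below some part of `Q`. -/
def Refines {E E' : Ω} (P : Finpartition E) (Q : Finpartition E') : Prop :=
  ∀ F ∈ P.parts, ∃ G ∈ Q.parts, F ≤ G

theorem part_unique {E : Ω} (Q : Finpartition E) {F G G' : Ω} (hF : F ≠ ⊥)
    (hG : G ∈ Q.parts) (hG' : G' ∈ Q.parts) (h : F ≤ G) (h' : F ≤ G') : G = G' := by
  by_contra hne
  exact hF (le_bot_iff.1 ((Q.disjoint hG hG' hne) h h'))

open scoped Classical in
/-- The component at `G ∈ Q` of the transition map is `∑_{F ∈ P, F ≤ G} μ(F ≤ G) x_F`. -/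
def pushFun (μ : Precosheaf 𝕜 Ω) {E E' : Ω} (P : Finpartition E) (Q : Finpartition E')
    (x : μ.sumOver P) : μ.sumOver Q :=
  WithLp.toLp 1 fun G => ∑ F : P.parts, if h : F.1 ≤ G.1 then μ.ext h (x F) else 0

theorem norm_pushFun_le (μ : Precosheaf 𝕜 Ω) {E E' : Ω} (P : Finpartition E)
    (Q : Finpartition E') (x : μ.sumOver P) : ‖μ.pushFun P Q x‖ ≤ ‖x‖ := by
  classical
  rw [PiLp.norm_eq_of_L1, PiLp.norm_eq_of_L1]
  calc ∑ G : Q.parts, ‖μ.pushFun P Q x G‖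
      ≤ ∑ G : Q.parts, ∑ F : P.parts, (if F.1 ≤ G.1 then ‖x F‖ else 0) := by
        refine Finset.sum_le_sum fun G _ => (norm_sum_le _ _).trans
          (Finset.sum_le_sum fun F _ => ?_)
        split_ifs with h
        · exact μ.norm_ext_apply_le h _
        · simp
    _ = ∑ F : P.parts, ∑ G : Q.parts, (if F.1 ≤ G.1 then ‖x F‖ else 0) := Finset.sum_comm
    _ ≤ ∑ F : P.parts, ‖x F‖ := by
        refine Finset.sum_le_sum fun F _ => ?_
        by_cases hex : ∃ G : Q.parts, F.1 ≤ G.1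
        · obtain ⟨G, hG⟩ := hex
          rw [Finset.sum_eq_single G]
          · simp [hG]
          · intro G' _ hne
            refine if_neg fun h => hne (Subtype.ext ?_)
            exact part_unique Q (P.ne_bot F.2) G'.2 G.2 h hG
          · simp
        · push Not at hex
          rw [Finset.sum_eq_zero fun G _ => if_neg (hex G)]
          exact norm_nonneg _

/-- The canonical contraction `∑_{F ∈ P} μ(F) → ∑_{G ∈ Q} μ(G)` (used when `P` refines `Q`),
which sends the summand `μ(F)` to the summand `μ(G)`, where `G` is the part of `Q` that
contains `F`. -/
def push (μ : Precosheaf 𝕜 Ω) {E E' : Ω} (P : Finpartition E) (Q : Finpartition E') :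
    μ.sumOver P →L[𝕜] μ.sumOver Q :=
  LinearMap.mkContinuous
    { toFun := μ.pushFun P Q
      map_add' := fun x y => by
        ext G
        simp only [pushFun, PiLp.add_apply, ← Finset.sum_add_distrib]
        refine Finset.sum_congr rfl fun F _ => ?_
        split_ifs <;> simp
      map_smul' := fun c x => by
        ext G
        simp only [pushFun, PiLp.smul_apply, RingHom.id_apply, Finset.smul_sum]
        refine Finset.sum_congr rfl fun F _ => ?_
        split_ifs <;> simp } 1
    (fun x => by simpa using μ.norm_pushFun_le P Q x)

theorem norm_push_le (μ : Precosheaf 𝕜 Ω) {E E' : Ω} (P : Finpartition E)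
    (Q : Finpartition E') : ‖μ.push P Q‖ ≤ 1 :=
  LinearMap.mkContinuous_norm_le _ zero_le_one _

open scoped Classical in
theorem push_apply (μ : Precosheaf 𝕜 Ω) {E E' : Ω} (P : Finpartition E) (Q : Finpartition E')
    (x : μ.sumOver P) (G : Q.parts) :
    μ.push P Q x G = ∑ F : P.parts, if h : F.1 ≤ G.1 then μ.ext h (x F) else 0 := rfl

theorem push_self (μ : Precosheaf 𝕜 Ω) {E : Ω} (P : Finpartition E) (x : μ.sumOver P) :
    μ.push P P x = x := by
  classical
  ext G
  rw [push_apply, Finset.sum_eq_single G]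
  · rw [dif_pos le_rfl, ext_self]
  · intro F _ hne
    exact dif_neg fun h => hne (Subtype.ext (part_unique P (P.ne_bot F.2) F.2 G.2 le_rfl h))
  · simp

theorem push_push (μ : Precosheaf 𝕜 Ω) {E E' E'' : Ω} {P : Finpartition E}
    {Q : Finpartition E'} {R : Finpartition E''} (hPQ : Refines P Q) (hQR : Refines Q R)
    (x : μ.sumOver P) : μ.push Q R (μ.push P Q x) = μ.push P R x := by
  classical
  ext K
  simp only [push_apply]
  have h1 : ∀ G : Q.parts, (if h : G.1 ≤ K.1 then
        μ.ext h (∑ F : P.parts, if h' : F.1 ≤ G.1 then μ.ext h' (x F) else 0) else 0) =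
      ∑ F : P.parts, if h : F.1 ≤ G.1 ∧ G.1 ≤ K.1 then μ.ext (h.1.trans h.2) (x F) else 0 := by
    intro G
    by_cases hG : G.1 ≤ K.1
    · rw [dif_pos hG, map_sum]
      refine Finset.sum_congr rfl fun F _ => ?_
      by_cases hF : F.1 ≤ G.1
      · rw [dif_pos hF, dif_pos ⟨hF, hG⟩, ext_ext]
      · rw [dif_neg hF, dif_neg fun h => hF h.1, map_zero]
    · rw [dif_neg hG]
      exact (Finset.sum_eq_zero fun F _ => dif_neg fun h => hG h.2).symm
  rw [Finset.sum_congr rfl fun G _ => h1 G, Finset.sum_comm]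
  refine Finset.sum_congr rfl fun F _ => ?_
  obtain ⟨G, hG, hFG⟩ := hPQ F.1 F.2
  rw [Finset.sum_eq_single (⟨G, hG⟩ : Q.parts)]
  · by_cases hFK : F.1 ≤ K.1
    · obtain ⟨K', hK', hGK'⟩ := hQR G hG
      have hK : K' = K.1 := part_unique R (P.ne_bot F.2) hK' K.2 (hFG.trans hGK') hFK
      rw [dif_pos hFK, dif_pos ⟨hFG, hK ▸ hGK'⟩]
    · rw [dif_neg hFK, dif_neg fun h => hFK (h.1.trans h.2)]
  · intro G' _ hne
    exact dif_neg fun h => hne (Subtype.ext (part_unique Q (P.ne_bot F.2) G'.2 hG h.1 hFG))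
  · simp

/-- The diagram `P ↦ ∑_{F ∈ P} μ(F)` over the poset of finite partitions of `E`, ordered by
refinement (`P ≤ Q` iff `P` refines `Q`). -/
def partitionDiagram (μ : Precosheaf 𝕜 Ω) (E : Ω) : Finpartition E ⥤ Banc.{v, u} 𝕜 where
  obj P := ⟨μ.sumOver P⟩
  map {P Q} _ := ⟨μ.push P Q, μ.norm_push_le P Q⟩
  map_id P := Banc.Hom.ext (ContinuousLinearMap.ext (μ.push_self P))
  map_comp f g := Banc.Hom.ext (ContinuousLinearMap.ext fun x =>
    (μ.push_push (fun _ h => leOfHom f h) (fun _ h => leOfHom g h) x).symm)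

/-! ### The limit over finite partitions -/

/-- The space of cogerms: compatible bounded families `θ_P ∈ ∑_{F ∈ P} μ(F)`, indexed by the finite
partitions `P` of `E`, with the norm `sup_P ‖θ_P‖`. -/
def cogerms (μ : Precosheaf 𝕜 Ω) (E : Ω) :
    Submodule 𝕜 (lp (fun P : Finpartition E => μ.sumOver P) ∞) where
  carrier := {θ | ∀ P Q : Finpartition E, P ≤ Q → μ.push P Q (θ P) = θ Q}
  zero_mem' := fun P Q h => by simp
  add_mem' := fun {a b} ha hb P Q h => by simp [ha P Q h, hb P Q h]
  smul_mem' := fun c a ha P Q h => by simp [ha P Q h]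

theorem norm_cogerm_apply_le {μ : Precosheaf 𝕜 Ω} {E : Ω} (θ : μ.cogerms E)
    (P : Finpartition E) : ‖θ.1 P‖ ≤ ‖θ‖ :=
  lp.norm_apply_le_norm ENNReal.top_ne_zero θ.1 P

/-- The projection of a cogerm to its component at `P`. -/
def proj (μ : Precosheaf 𝕜 Ω) (E : Ω) (P : Finpartition E) : μ.cogerms E →L[𝕜] μ.sumOver P :=
  LinearMap.mkContinuous
    { toFun := fun θ => θ.1 P
      map_add' := fun _ _ => rfl
      map_smul' := fun _ _ => rfl } 1 (fun θ => (norm_cogerm_apply_le θ P).trans_eq (one_mul _).symm)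

instance (μ : Precosheaf 𝕜 Ω) (E : Ω) : CompleteSpace (μ.cogerms E) := by
  have hc : ∀ P : Finpartition E,
      Continuous fun θ : lp (fun P : Finpartition E => μ.sumOver P) ∞ => θ P := fun P =>
    (lp.evalCLM 𝕜 (fun P : Finpartition E => μ.sumOver P) ∞ P).continuous
  have hcl : IsClosed
      {θ : lp (fun P : Finpartition E => μ.sumOver P) ∞ |
        ∀ P Q : Finpartition E, P ≤ Q → μ.push P Q (θ P) = θ Q} := by
    simp only [Set.ofPred_forall]
    exact isClosed_iInter fun P => isClosed_iInter fun Q => isClosed_iInter fun _ =>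
      isClosed_eq ((μ.push P Q).continuous.comp (hc P)) (hc Q)
  exact hcl.completeSpace_coe

/-- Build a bounded operator into the space of cogerms from a compatible family of bounded
operators into the coproducts. -/
def toCogerms (μ : Precosheaf 𝕜 Ω) (E : Ω) {A : Type u} [NormedAddCommGroup A] [NormedSpace 𝕜 A]
    (t : ∀ P : Finpartition E, A →L[𝕜] μ.sumOver P) (C : ℝ) (hC : 0 ≤ C)
    (bound : ∀ P x, ‖t P x‖ ≤ C * ‖x‖)
    (compat : ∀ P Q : Finpartition E, P ≤ Q → ∀ x, μ.push P Q (t P x) = t Q x) :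
    A →L[𝕜] μ.cogerms E :=
  LinearMap.mkContinuous
    { toFun := fun x => ⟨⟨fun P => t P x, memℓp_infty
        ⟨C * ‖x‖, by rintro _ ⟨P, rfl⟩; exact bound P x⟩⟩, fun P Q h => compat P Q h x⟩
      map_add' := fun x y => Subtype.ext (lp.ext (funext fun P => map_add (t P) x y))
      map_smul' := fun c x => Subtype.ext (lp.ext (funext fun P => map_smul (t P) c x)) } C
    (fun x => lp.norm_le_of_forall_le (mul_nonneg hC (norm_nonneg _)) fun P => bound P x)

theorem norm_toCogerms_le (μ : Precosheaf 𝕜 Ω) (E : Ω) {A : Type u} [NormedAddCommGroup A]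
    [NormedSpace 𝕜 A] (t : ∀ P : Finpartition E, A →L[𝕜] μ.sumOver P) (C : ℝ) (hC : 0 ≤ C)
    (bound : ∀ P x, ‖t P x‖ ≤ C * ‖x‖)
    (compat : ∀ P Q : Finpartition E, P ≤ Q → ∀ x, μ.push P Q (t P x) = t Q x) :
    ‖μ.toCogerms E t C hC bound compat‖ ≤ C :=
  ContinuousLinearMap.opNorm_le_bound _ hC fun x =>
    lp.norm_le_of_forall_le (mul_nonneg hC (norm_nonneg _)) fun P => bound P x

theorem cogerms_ext {μ : Precosheaf 𝕜 Ω} {E : Ω} {θ θ' : μ.cogerms E}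
    (h : ∀ P, θ.1 P = θ'.1 P) : θ = θ' :=
  Subtype.ext (lp.ext (funext h))

/-- The cone of the projections from the space of cogerms. -/
def cogermCone (μ : Precosheaf 𝕜 Ω) (E : Ω) : Limits.Cone (μ.partitionDiagram E) where
  pt := ⟨μ.cogerms E⟩
  π :=
    { app := fun P => ⟨μ.proj E P, LinearMap.mkContinuous_norm_le _ zero_le_one _⟩
      naturality := fun P Q f => Banc.Hom.ext (ContinuousLinearMap.ext fun θ =>
        (θ.2 P Q (leOfHom f)).symm) }

/-! ### The functor `μ ↦ (E ↦ lim_P ∑_{F ∈ P} μ(F))` -/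

open scoped Classical in
/-- The partition of `E` induced by a partition of a larger element. -/
def restr {E E' : Ω} (h : E ≤ E') (P : Finpartition E') : Finpartition E := P.restrict h

theorem exists_of_mem_restr {E E' : Ω} (h : E ≤ E') (P : Finpartition E') {F : Ω}
    (hF : F ∈ (restr h P).parts) : F ≠ ⊥ ∧ ∃ G ∈ P.parts, G ⊓ E = F := by
  classical
  exact ⟨(restr h P).ne_bot hF, Finset.mem_image.1 (Finset.mem_of_mem_erase hF)⟩

theorem mem_restr {E E' : Ω} (h : E ≤ E') (P : Finpartition E') {G : Ω} (hG : G ∈ P.parts)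
    (hne : G ⊓ E ≠ ⊥) : G ⊓ E ∈ (restr h P).parts := by
  classical
  exact Finset.mem_erase.2 ⟨hne, Finset.mem_image_of_mem _ hG⟩

theorem restr_refines {E E' : Ω} (h : E ≤ E') (P : Finpartition E') : Refines (restr h P) P := by
  intro F hF
  obtain ⟨-, G, hG, rfl⟩ := exists_of_mem_restr h P hF
  exact ⟨G, hG, inf_le_left⟩

theorem restr_mono {E E' : Ω} (h : E ≤ E') {P Q : Finpartition E'} (hPQ : P ≤ Q) :
    restr h P ≤ restr h Q := by
  intro F hF
  obtain ⟨hne, G, hG, rfl⟩ := exists_of_mem_restr h P hF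
  obtain ⟨K, hK, hGK⟩ := hPQ hG
  have hle : G ⊓ E ≤ K ⊓ E := inf_le_inf_right _ hGK
  exact ⟨K ⊓ E, mem_restr h Q hK (ne_bot_of_le_ne_bot hne hle), hle⟩

theorem restr_restr_le {E E' E'' : Ω} (h : E ≤ E') (h' : E' ≤ E'') (P : Finpartition E'') :
    restr h (restr h' P) ≤ restr (h.trans h') P := by
  intro F hF
  obtain ⟨hne, G, hG, rfl⟩ := exists_of_mem_restr h _ hF
  obtain ⟨-, K, hK, rfl⟩ := exists_of_mem_restr h' P hG
  have hle : K ⊓ E' ⊓ E ≤ K ⊓ E := inf_le_inf_right _ inf_le_left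
  exact ⟨K ⊓ E, mem_restr _ P hK (ne_bot_of_le_ne_bot hne hle), hle⟩

theorem restr_self_le {E : Ω} (P : Finpartition E) : restr le_rfl P ≤ P :=
  restr_refines le_rfl P

/-- For `E ≤ E'`, the induced map on limits sends a cogerm `θ` over `E` to the cogerm over `E'`
whose component at a partition `P` of `E'` is the image of the component of `θ` at the induced
partition `{F ⊓ E : F ∈ P, F ⊓ E ≠ ⊥}` of `E`. -/
def cogermsExt (μ : Precosheaf 𝕜 Ω) {E E' : Ω} (h : E ≤ E') :
    μ.cogerms E →L[𝕜] μ.cogerms E' :=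
  μ.toCogerms E' (fun P => (μ.push (restr h P) P).comp (μ.proj E (restr h P))) 1 zero_le_one
    (fun P θ => by
      rw [one_mul]
      exact (μ.norm_pushFun_le _ _ _).trans (norm_cogerm_apply_le θ _))
    (fun P Q hPQ θ => by
      change μ.push P Q (μ.push (restr h P) P (θ.1 (restr h P))) =
        μ.push (restr h Q) Q (θ.1 (restr h Q))
      rw [μ.push_push (restr_refines h P) hPQ, ← θ.2 _ _ (restr_mono h hPQ),
        μ.push_push (restr_mono h hPQ) (restr_refines h Q)])

theorem cogermsExt_apply (μ : Precosheaf 𝕜 Ω) {E E' : Ω} (h : E ≤ E') (θ : μ.cogerms E)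
    (P : Finpartition E') :
    (μ.cogermsExt h θ).1 P = μ.push (restr h P) P (θ.1 (restr h P)) := rfl

theorem norm_cogermsExt_le (μ : Precosheaf 𝕜 Ω) {E E' : Ω} (h : E ≤ E') :
    ‖μ.cogermsExt h‖ ≤ 1 :=
  μ.norm_toCogerms_le E' _ 1 _ _ _

theorem cogermsExt_self (μ : Precosheaf 𝕜 Ω) {E : Ω} (h : E ≤ E) (θ : μ.cogerms E) :
    μ.cogermsExt h θ = θ :=
  cogerms_ext fun P => θ.2 _ _ (restr_self_le P)

theorem cogermsExt_cogermsExt (μ : Precosheaf 𝕜 Ω) {E E' E'' : Ω} (h : E ≤ E') (h' : E' ≤ E'')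
    (θ : μ.cogerms E) : μ.cogermsExt h' (μ.cogermsExt h θ) = μ.cogermsExt (h.trans h') θ :=
  cogerms_ext fun P => by
    simp only [cogermsExt_apply]
    rw [μ.push_push (restr_refines h _) (restr_refines h' P),
      ← θ.2 _ _ (restr_restr_le h h' P),
      μ.push_push (restr_restr_le h h' P) (restr_refines _ P)]

/-- The precosheaf `E ↦ lim_P ∑_{F ∈ P} μ(F)`. -/
def hat (μ : Precosheaf 𝕜 Ω) : Precosheaf 𝕜 Ω where
  functor :=
    { obj := fun E => (μ.cogermCone E).pt
      map := fun f => ⟨μ.cogermsExt (leOfHom f), μ.norm_cogermsExt_le (leOfHom f)⟩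
      map_id := fun E => Banc.Hom.ext (ContinuousLinearMap.ext (μ.cogermsExt_self le_rfl))
      map_comp := fun f g => Banc.Hom.ext (ContinuousLinearMap.ext fun θ =>
        (μ.cogermsExt_cogermsExt (leOfHom f) (leOfHom g) θ).symm) }

/-- The map of coproducts `∑_{F ∈ P} μ(F) → ∑_{F ∈ P} ν(F)` induced by a morphism `μ → ν`. -/
def sumOverMap {μ ν : Precosheaf 𝕜 Ω} (τ : μ ⟶ ν) {E : Ω} (P : Finpartition E) :
    μ.sumOver P →L[𝕜] ν.sumOver P :=
  LinearMap.mkContinuous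
    { toFun := fun x => WithLp.toLp 1 fun F => app τ F.1 (x F)
      map_add' := fun x y => by ext F; simp
      map_smul' := fun c x => by ext F; simp } ‖τ‖
    (fun x => by
      rw [PiLp.norm_eq_of_L1, PiLp.norm_eq_of_L1, Finset.mul_sum]
      exact Finset.sum_le_sum fun F _ => norm_app_apply_le τ F.1 (x F))

theorem sumOverMap_apply {μ ν : Precosheaf 𝕜 Ω} (τ : μ ⟶ ν) {E : Ω} (P : Finpartition E)
    (x : μ.sumOver P) (F : P.parts) : sumOverMap τ P x F = app τ F.1 (x F) := rfl

theorem push_sumOverMap {μ ν : Precosheaf 𝕜 Ω} (τ : μ ⟶ ν) {E E' : Ω} (P : Finpartition E)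
    (Q : Finpartition E') (x : μ.sumOver P) :
    ν.push P Q (sumOverMap τ P x) = sumOverMap τ Q (μ.push P Q x) := by
  classical
  ext G
  simp only [push_apply, sumOverMap_apply, map_sum]
  refine Finset.sum_congr rfl fun F _ => ?_
  split_ifs with h
  · exact (app_ext τ h _).symm
  · simp

/-- The map of limits induced by a morphism of precosheaves, at `E`. -/
def cogermsMap {μ ν : Precosheaf 𝕜 Ω} (τ : μ ⟶ ν) (E : Ω) : μ.cogerms E →L[𝕜] ν.cogerms E :=
  ν.toCogerms E (fun P => (sumOverMap τ P).comp (μ.proj E P)) ‖τ‖ (norm_nonneg _)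
    (fun P θ => ((sumOverMap τ P).le_of_opNorm_le
      (LinearMap.mkContinuous_norm_le _ (norm_nonneg _) _) (θ.1 P)).trans
      (mul_le_mul_of_nonneg_left (norm_cogerm_apply_le θ P) (norm_nonneg _)))
    (fun P Q h θ => by
      change ν.push P Q (sumOverMap τ P (θ.1 P)) = sumOverMap τ Q (θ.1 Q)
      rw [push_sumOverMap, θ.2 P Q h])

/-- The functor `μ ↦ (E ↦ lim_P ∑_{F ∈ P} μ(F))` from precosheaves to precosheaves. -/
def hatFunctor (𝕜 : Type v) [RCLike 𝕜] (Ω : Type u) [BooleanAlgebra Ω] :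
    Precosheaf 𝕜 Ω ⥤ Precosheaf 𝕜 Ω where
  obj μ := μ.hat
  map {μ ν} τ := natTrans.mk' (μ := μ.hat) (ν := ν.hat) (fun E => cogermsMap τ E) ‖τ‖
    (fun E => ν.norm_toCogerms_le E _ ‖τ‖ _ _ _)
    (fun E _ h (θ : μ.cogerms E) => cogerms_ext fun P =>
      (push_sumOverMap τ (restr h P) P (θ.1 (restr h P))).symm)
  map_id _ := rfl
  map_comp _ _ := rfl

end Precosheaf

end

end Cosheafification

/-! Two things need proof: each `μ.hat` is a cosheaf, and morphisms from a cosheaf into `μ` lift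
uniquely to `μ.hat` with the same norm.

For `F ≤ E`, a cogerm over `E` restricts to `F`: extend a partition of `F` by the part `E \ F`, take
the component there, and discard the summand at `E \ F` (`restrictCogerms`). Over a partition `P` of
`E`, the restrictions to the parts invert `μ.hat.sumMap P`. They are a left inverse because
restriction undoes extension from the same part and kills extension from a disjoint one. They are
jointly injective because the refinements of `P` are cofinal and each of their parts lies in a
single part of `P` (`cogerms_ext_of_restrict`). The inverse is contractive because partitions nearly
attaining the norms on the parts glue to one partition of `E`, over which the `ℓ¹` norm splits
(`sum_norm_restrictCogerms_le`).

For a cosheaf `ν` the maps `ε_P` are invertible isometries, so `τ : ν ⟶ μ` lifts to `x ↦ (τ (ε_P⁻¹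
x))_P`. The lift is unique because the `G`-component at `P` of a sum of cogerms over the parts of
`P` is the counit applied to its summand at `G` (`hat_sumMap_apply_self`). Lifting and composing
with the counit are mutually inverse contractions, hence isometries. -/

namespace Cosheafification

namespace Precosheaf

noncomputable section

variable {𝕜 : Type v} [RCLike 𝕜] {Ω : Type u} [BooleanAlgebra Ω]

/-! ### Transition maps -/

/-- Unlike in `push_push`, parts of `P` need not lie below any part of `R`: such parts contribute
zero on both sides. This covers passage to a smaller element, where the summands outside it are
discarded. -/
theorem push_push_of_factors (μ : Precosheaf 𝕜 Ω) {E E' E'' : Ω} {P : Finpartition E}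
    {Q : Finpartition E'} {R : Finpartition E''}
    (H : ∀ F ∈ P.parts, ∀ K ∈ R.parts, F ≤ K → ∃ G ∈ Q.parts, F ≤ G ∧ G ≤ K)
    (x : μ.sumOver P) : μ.push Q R (μ.push P Q x) = μ.push P R x := by
  classical
  ext K
  simp only [push_apply]
  have h1 : ∀ G : Q.parts, (if h : G.1 ≤ K.1 then
        μ.ext h (∑ F : P.parts, if h' : F.1 ≤ G.1 then μ.ext h' (x F) else 0) else 0) =
      ∑ F : P.parts, if h : F.1 ≤ G.1 ∧ G.1 ≤ K.1 then μ.ext (h.1.trans h.2) (x F) else 0 := by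
    intro G
    by_cases hG : G.1 ≤ K.1
    · rw [dif_pos hG, map_sum]
      refine Finset.sum_congr rfl fun F _ => ?_
      by_cases hF : F.1 ≤ G.1
      · rw [dif_pos hF, dif_pos ⟨hF, hG⟩, ext_ext]
      · rw [dif_neg hF, dif_neg fun h => hF h.1, map_zero]
    · rw [dif_neg hG]
      exact (Finset.sum_eq_zero fun F _ => dif_neg fun h => hG h.2).symm
  rw [Finset.sum_congr rfl fun G _ => h1 G, Finset.sum_comm]
  refine Finset.sum_congr rfl fun F _ => ?_
  by_cases hFK : F.1 ≤ K.1
  · obtain ⟨G, hG, hFG, hGK⟩ := H F.1 F.2 K.1 K.2 hFK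
    rw [Finset.sum_eq_single (⟨G, hG⟩ : Q.parts), dif_pos hFK, dif_pos ⟨hFG, hGK⟩]
    · intro G' _ hne
      exact dif_neg fun h => hne (Subtype.ext (part_unique Q (P.ne_bot F.2) G'.2 hG h.1 hFG))
    · simp
  · rw [dif_neg hFK]
    exact Finset.sum_eq_zero fun G _ => dif_neg fun h => hFK (h.1.trans h.2)

theorem push_apply_of_mem (μ : Precosheaf 𝕜 Ω) {E E' : Ω} (P : Finpartition E)
    (Q : Finpartition E') (x : μ.sumOver P) {G : Ω} (hP : G ∈ P.parts) (hQ : G ∈ Q.parts) :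
    μ.push P Q x ⟨G, hQ⟩ = x ⟨G, hP⟩ := by
  classical
  rw [push_apply, Finset.sum_eq_single (⟨G, hP⟩ : P.parts)]
  · rw [dif_pos le_rfl, ext_self]
  · intro F _ hne
    exact dif_neg fun h => hne (Subtype.ext (part_unique P (P.ne_bot F.2) F.2 hP le_rfl h))
  · simp

theorem push_eq_zero_of_disjoint (μ : Precosheaf 𝕜 Ω) {E E' : Ω} (P : Finpartition E)
    (Q : Finpartition E') (h : Disjoint E E') (x : μ.sumOver P) : μ.push P Q x = 0 := by
  classical
  ext G
  rw [push_apply]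
  exact Finset.sum_eq_zero fun F _ => dif_neg fun hFG =>
    P.ne_bot F.2 (le_bot_iff.1 (h (P.le F.2) (hFG.trans (Q.le G.2))))

open scoped Classical in
/-- The norm of the image under a transition map only involves the summands of the source that lie
below the support of the target. -/
theorem norm_push_le_sum (μ : Precosheaf 𝕜 Ω) {E E' : Ω} (P : Finpartition E)
    (Q : Finpartition E') (x : μ.sumOver P) :
    ‖μ.push P Q x‖ ≤ ∑ K : P.parts, if K.1 ≤ E' then ‖x K‖ else 0 := by
  -- Truncating `x` to the summands below `E'` does not change its image, so contractivity can be
  -- applied to the truncation.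
  let y : μ.sumOver P := WithLp.toLp 1 fun K => if K.1 ≤ E' then x K else 0
  have hy : μ.push P Q x = μ.push P Q y := by
    ext G
    rw [push_apply, push_apply]
    refine Finset.sum_congr rfl fun F _ => ?_
    by_cases h : F.1 ≤ G.1
    · rw [dif_pos h, dif_pos h]
      exact congrArg _ (if_pos (h.trans (Q.le G.2))).symm
    · rw [dif_neg h, dif_neg h]
  rw [hy]
  refine (μ.norm_pushFun_le P Q y).trans_eq ?_
  rw [PiLp.norm_eq_of_L1]
  refine Finset.sum_congr rfl fun K _ => ?_
  change ‖if K.1 ≤ E' then x K else 0‖ = _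
  split_ifs <;> simp

/-- A part of `R` is nonzero, so it lies below at most one part of `P`, and each `‖x K‖` is counted
at most once. -/
theorem sum_norm_push_le (μ : Precosheaf 𝕜 Ω) {E E' : Ω} (P : Finpartition E)
    (R : Finpartition E') (Q : ∀ F : P.parts, Finpartition F.1) (x : μ.sumOver R) :
    ∑ F : P.parts, ‖μ.push R (Q F) x‖ ≤ ‖x‖ := by
  classical
  rw [PiLp.norm_eq_of_L1]
  calc ∑ F : P.parts, ‖μ.push R (Q F) x‖
      ≤ ∑ F : P.parts, ∑ K : R.parts, (if K.1 ≤ F.1 then ‖x K‖ else 0) :=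
        Finset.sum_le_sum fun F _ => μ.norm_push_le_sum R (Q F) x
    _ = ∑ K : R.parts, ∑ F : P.parts, (if K.1 ≤ F.1 then ‖x K‖ else 0) := Finset.sum_comm
    _ ≤ ∑ K : R.parts, ‖x K‖ := by
        refine Finset.sum_le_sum fun K _ => ?_
        by_cases hex : ∃ F : P.parts, K.1 ≤ F.1
        · obtain ⟨F, hF⟩ := hex
          rw [Finset.sum_eq_single F]
          · simp [hF]
          · intro F' _ hne
            exact if_neg fun h => hne (Subtype.ext (part_unique P (R.ne_bot K.2) F'.2 F.2 h hF))
          · simp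
        · push Not at hex
          rw [Finset.sum_eq_zero fun F _ => if_neg (hex F)]
          exact norm_nonneg _

/-- Each part of `P` reaches `E'` through exactly one part of `Q`. The case `E = E'` makes the
counit well defined; the general case makes it natural. -/
theorem sumMap_push (μ : Precosheaf 𝕜 Ω) {E E' : Ω} (h : E ≤ E') {P : Finpartition E}
    {Q : Finpartition E'} (hPQ : Refines P Q) (x : μ.sumOver P) :
    μ.sumMap Q (μ.push P Q x) = μ.ext h (μ.sumMap P x) := by
  classical
  simp only [sumMap, push_apply, map_sum]
  rw [Finset.sum_comm]
  refine Finset.sum_congr rfl fun F _ => ?_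
  obtain ⟨G, hG, hFG⟩ := hPQ F.1 F.2
  rw [Finset.sum_eq_single (⟨G, hG⟩ : Q.parts), dif_pos hFG, ext_ext, ext_ext]
  · intro G' _ hne
    rw [dif_neg fun h => hne (Subtype.ext (part_unique Q (P.ne_bot F.2) G'.2 hG h hFG)), map_zero]
  · simp

/-- Both sides are compared with the common refinement `P ⊓ Q`. -/
theorem sumMap_cogerm (μ : Precosheaf 𝕜 Ω) {E : Ω} (θ : μ.cogerms E) (P Q : Finpartition E) :
    μ.sumMap P (θ.1 P) = μ.sumMap Q (θ.1 Q) := by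
  classical
  have key : ∀ R : Finpartition E, P ⊓ Q ≤ R →
      μ.sumMap R (θ.1 R) = μ.sumMap (P ⊓ Q) (θ.1 (P ⊓ Q)) := fun R h => by
    rw [← θ.2 _ _ h, μ.sumMap_push le_rfl fun _ hF => h hF, ext_self]
  rw [key P inf_le_left, key Q inf_le_right]

theorem sumMap_add (μ : Precosheaf 𝕜 Ω) {E : Ω} (P : Finpartition E) (x y : μ.sumOver P) :
    μ.sumMap P (x + y) = μ.sumMap P x + μ.sumMap P y := by
  simp [sumMap, Finset.sum_add_distrib]

theorem sumMap_smul (μ : Precosheaf 𝕜 Ω) {E : Ω} (P : Finpartition E) (c : 𝕜)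
    (x : μ.sumOver P) : μ.sumMap P (c • x) = c • μ.sumMap P x := by
  simp [sumMap, Finset.smul_sum]

theorem norm_sumMap_le (μ : Precosheaf 𝕜 Ω) {E : Ω} (P : Finpartition E) (x : μ.sumOver P) :
    ‖μ.sumMap P x‖ ≤ ‖x‖ := by
  rw [PiLp.norm_eq_of_L1]
  exact (norm_sum_le _ _).trans (Finset.sum_le_sum fun F _ => μ.norm_ext_apply_le _ _)

theorem sumMap_sumOverMap {μ ν : Precosheaf 𝕜 Ω} (τ : μ ⟶ ν) {E : Ω} (P : Finpartition E)
    (x : μ.sumOver P) : ν.sumMap P (sumOverMap τ P x) = app τ E (μ.sumMap P x) := by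
  simp only [sumMap, map_sum, sumOverMap_apply, app_ext]

/-! ### Restriction of cogerms to a smaller element -/

/-- The partition of `E` obtained from a partition of `F ≤ E` by adding the part `E \ F`. -/
def extend {E F : Ω} (h : F ≤ E) (Q : Finpartition F) : Finpartition E := by
  classical
  exact if hb : E \ F = ⊥ then Q.copy (le_antisymm h (sdiff_eq_bot_iff.1 hb))
    else Q.extend hb disjoint_sdiff_self_right (sup_sdiff_cancel_right h)

theorem mem_extend {E F : Ω} (h : F ≤ E) (Q : Finpartition F) {K : Ω} :
    K ∈ (extend h Q).parts ↔ K ∈ Q.parts ∨ (K = E \ F ∧ E \ F ≠ ⊥) := by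
  classical
  unfold extend
  split_ifs with hb
  · simp [hb]
  · simp [hb, or_comm]

theorem extend_mono {E F : Ω} (h : F ≤ E) {Q Q' : Finpartition F} (hQ : Q ≤ Q') :
    extend h Q ≤ extend h Q' := by
  intro K hK
  rcases (mem_extend h Q).1 hK with hK | hK
  · obtain ⟨G, hG, hle⟩ := hQ hK
    exact ⟨G, (mem_extend h Q').2 (Or.inl hG), hle⟩
  · exact ⟨K, (mem_extend h Q').2 (Or.inr hK), le_rfl⟩

/-- A partition refines an extension if each of its parts lies below a part of the given partition
or is disjoint from its support. -/
theorem le_extend {E F : Ω} (h : F ≤ E) {Q : Finpartition F} {R : Finpartition E}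
    (H : ∀ K ∈ R.parts, (∃ G ∈ Q.parts, K ≤ G) ∨ Disjoint K F) : R ≤ extend h Q := by
  intro K hK
  rcases H K hK with ⟨G, hG, hle⟩ | hd
  · exact ⟨G, (mem_extend h Q).2 (Or.inl hG), hle⟩
  · have hle : K ≤ E \ F := le_sdiff.2 ⟨R.le hK, hd⟩
    exact ⟨E \ F, (mem_extend h Q).2 (Or.inr ⟨rfl, ne_bot_of_le_ne_bot (R.ne_bot hK) hle⟩), hle⟩

/-- Every part of `Q` is itself a part of `extend h Q`, so it serves as its own intermediate part.
-/
theorem push_push_extend (μ : Precosheaf 𝕜 Ω) {E E' F : Ω} (h : F ≤ E) {Q : Finpartition F}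
    (R : Finpartition E') (x : μ.sumOver R) :
    μ.push (extend h Q) Q (μ.push R (extend h Q) x) = μ.push R Q x :=
  μ.push_push_of_factors (fun _ _ G hG hle => ⟨G, (mem_extend h Q).2 (Or.inl hG), hle, le_rfl⟩) x

/-- The restriction of cogerms from `E` to `F ≤ E`. -/
def restrictCogerms (μ : Precosheaf 𝕜 Ω) {E F : Ω} (h : F ≤ E) :
    μ.cogerms E →L[𝕜] μ.cogerms F :=
  μ.toCogerms F (fun Q => (μ.push (extend h Q) Q).comp (μ.proj E (extend h Q))) 1 zero_le_one
    (fun Q θ => by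
      rw [one_mul]
      exact (μ.norm_pushFun_le _ _ _).trans (norm_cogerm_apply_le θ _))
    (fun Q Q' hQ θ => by
      change μ.push Q Q' (μ.push (extend h Q) Q (θ.1 (extend h Q))) =
        μ.push (extend h Q') Q' (θ.1 (extend h Q'))
      rw [← θ.2 _ _ (extend_mono h hQ), push_push_extend]
      refine μ.push_push_of_factors (fun K hK G hG hle => ?_) _
      rcases (mem_extend h Q).1 hK with hK | ⟨rfl, hne⟩
      · exact ⟨K, hK, le_rfl, hle⟩
      -- The added part `E \ F` is nonzero and disjoint from `F`, so it lies below no part of `Q'`.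
      · exact absurd (disjoint_self.1 (disjoint_sdiff_self_left.mono_right
          (hle.trans (Q'.le hG)))) hne)

theorem restrictCogerms_apply (μ : Precosheaf 𝕜 Ω) {E F : Ω} (h : F ≤ E) (θ : μ.cogerms E)
    (Q : Finpartition F) :
    (μ.restrictCogerms h θ).1 Q = μ.push (extend h Q) Q (θ.1 (extend h Q)) := rfl

/-- Such an `R` refines `extend h Q`, so compatibility of `θ` applies. Restrictions can thus be
computed from any convenient fine partition of `E`. -/
theorem restrictCogerms_apply_eq_push (μ : Precosheaf 𝕜 Ω) {E F : Ω} (h : F ≤ E)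
    (θ : μ.cogerms E) {Q : Finpartition F} {R : Finpartition E}
    (H : ∀ K ∈ R.parts, (∃ G ∈ Q.parts, K ≤ G) ∨ Disjoint K F) :
    (μ.restrictCogerms h θ).1 Q = μ.push R Q (θ.1 R) := by
  rw [restrictCogerms_apply, ← θ.2 _ _ (le_extend h H), push_push_extend]

theorem restrictCogerms_cogermsExt (μ : Precosheaf 𝕜 Ω) {E F : Ω} (h : F ≤ E)
    (θ : μ.cogerms F) : μ.restrictCogerms h (μ.cogermsExt h θ) = θ := by
  refine cogerms_ext fun Q => ?_
  rw [restrictCogerms_apply, cogermsExt_apply, push_push_extend]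
  -- It remains that `extend h Q`, cut down to `F`, refines `Q`: the part `E \ F` meets `F` in `⊥`
  -- and disappears.
  refine θ.2 _ _ fun K hK => ?_
  obtain ⟨hne, G, hG, rfl⟩ := exists_of_mem_restr h _ hK
  rcases (mem_extend h Q).1 hG with hG | ⟨rfl, -⟩
  · exact ⟨G, hG, inf_le_left⟩
  · exact absurd disjoint_sdiff_self_left.eq_bot hne

theorem restrictCogerms_cogermsExt_of_disjoint (μ : Precosheaf 𝕜 Ω) {E F F' : Ω} (h : F ≤ E)
    (h' : F' ≤ E) (hd : Disjoint F' F) (θ : μ.cogerms F') :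
    μ.restrictCogerms h (μ.cogermsExt h' θ) = 0 := by
  refine cogerms_ext fun Q => ?_
  rw [restrictCogerms_apply, cogermsExt_apply, push_push_extend]
  exact μ.push_eq_zero_of_disjoint _ _ hd _

/-- It suffices to compare components at partitions `S` refining `P`. A part `K` of `S` lies in some
part `F` of `P`, and the `K`-component is visible in the restriction to `F`. -/
theorem cogerms_ext_of_restrict (μ : Precosheaf 𝕜 Ω) {E : Ω} (P : Finpartition E)
    {θ θ' : μ.cogerms E}
    (H : ∀ F (hF : F ∈ P.parts), μ.restrictCogerms (P.le hF) θ = μ.restrictCogerms (P.le hF) θ') :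
    θ = θ' := by
  classical
  refine cogerms_ext fun R => ?_
  suffices hS : θ.1 (R ⊓ P) = θ'.1 (R ⊓ P) by
    rw [← θ.2 _ _ (inf_le_left : R ⊓ P ≤ R), ← θ'.2 _ _ (inf_le_left : R ⊓ P ≤ R), hS]
  have hSP : R ⊓ P ≤ P := inf_le_right
  generalize R ⊓ P = S at hSP
  ext ⟨K, hK⟩
  obtain ⟨F, hF, hKF⟩ := hSP hK
  have hFE : F ≤ E := P.le hF
  have hadapt : ∀ K' ∈ S.parts, (∃ G ∈ (restr hFE S).parts, K' ≤ G) ∨ Disjoint K' F := by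
    -- Each part of `S` lies either in `F` or in another part of `P`, which is disjoint from `F`.
    intro K' hK'
    obtain ⟨F', hF', hKF'⟩ := hSP hK'
    by_cases hFF : F' = F
    · subst hFF
      have hinf : K' ⊓ F' = K' := inf_eq_left.2 hKF'
      exact Or.inl ⟨K' ⊓ F', mem_restr hFE S hK' (hinf.symm ▸ S.ne_bot hK'), hinf.ge⟩
    · exact Or.inr ((P.disjoint hF' hF hFF).mono_left hKF')
  have hinf : K ⊓ F = K := inf_eq_left.2 hKF
  have hKr : K ∈ (restr hFE S).parts := by
    have := mem_restr hFE S hK (hinf.symm ▸ S.ne_bot hK)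
    rwa [hinf] at this
  have h1 := congrArg (fun ζ : μ.cogerms F => ζ.1 (restr hFE S) ⟨K, hKr⟩) (H F hF)
  simpa only [μ.restrictCogerms_apply_eq_push hFE _ hadapt,
    μ.push_apply_of_mem S (restr hFE S) _ hK hKr] using h1

/-! ### The limit precosheaf is a cosheaf -/

/-- Norms of cogerms are suprema over partitions. Near-optimal partitions `Q F` of the parts glue to
a partition `R` of `E`, and the single element `θ_R` bounds all the terms at once. -/
theorem sum_norm_restrictCogerms_le (μ : Precosheaf 𝕜 Ω) {E : Ω} (P : Finpartition E)
    (θ : μ.cogerms E) : ∑ F : P.parts, ‖μ.restrictCogerms (P.le F.2) θ‖ ≤ ‖θ‖ := by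
  classical
  refine le_of_forall_pos_le_add fun ε hε => ?_
  -- The `+ 1` keeps the denominator positive when `P` has no parts, that is, when `E = ⊥`.
  set δ : ℝ := ε / (Fintype.card P.parts + 1) with hδ
  have hδ0 : 0 < δ := by positivity
  have hex : ∀ F : P.parts, ∃ Q : Finpartition F.1,
      ‖μ.restrictCogerms (P.le F.2) θ‖ ≤ ‖(μ.restrictCogerms (P.le F.2) θ).1 Q‖ + δ := by
    intro F
    by_contra! hcon
    have : ‖μ.restrictCogerms (P.le F.2) θ‖ ≤ ‖μ.restrictCogerms (P.le F.2) θ‖ - δ := by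
      -- The supremum bound requires a nonnegative constant; the component at `⊤` supplies this.
      have hnonneg := norm_nonneg ((μ.restrictCogerms (P.le F.2) θ).1 ⊤)
      exact lp.norm_le_of_forall_le (by linarith [hcon ⊤])
        fun Q => le_sub_iff_add_le.2 (hcon Q).le
    linarith
  choose Q hQ using hex
  let R : Finpartition E := P.bind fun F hF => Q ⟨F, hF⟩
  have hR : ∀ F : P.parts, (μ.restrictCogerms (P.le F.2) θ).1 (Q F) = μ.push R (Q F) (θ.1 R) := by
    intro F
    refine μ.restrictCogerms_apply_eq_push _ _ fun K hK => ?_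
    obtain ⟨F', hF', hK⟩ := Finpartition.mem_bind.1 hK
    by_cases hFF : (⟨F', hF'⟩ : P.parts) = F
    · subst hFF
      exact Or.inl ⟨K, hK, le_rfl⟩
    · exact Or.inr ((P.disjoint hF' F.2 fun h => hFF (Subtype.ext h)).mono_left
        ((Q ⟨F', hF'⟩).le hK))
  calc ∑ F : P.parts, ‖μ.restrictCogerms (P.le F.2) θ‖
      ≤ ∑ F : P.parts, (‖μ.push R (Q F) (θ.1 R)‖ + δ) :=
        Finset.sum_le_sum fun F _ => (hQ F).trans_eq (by rw [hR F])
    _ = ∑ F : P.parts, ‖μ.push R (Q F) (θ.1 R)‖ + Fintype.card P.parts * δ := by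
        rw [Finset.sum_add_distrib]; simp
    _ ≤ ‖θ‖ + ε := by
        refine add_le_add ((μ.sum_norm_push_le P R Q _).trans (norm_cogerm_apply_le θ R)) ?_
        rw [hδ, mul_div_assoc', div_le_iff₀ (by positivity)]
        nlinarith

theorem hat_sumMap (μ : Precosheaf 𝕜 Ω) {E : Ω} (P : Finpartition E) (x : μ.hat.sumOver P) :
    μ.hat.sumMap P x = ∑ F : P.parts, μ.cogermsExt (P.le F.2) (x F) := rfl

theorem restrictCogerms_hat_sumMap (μ : Precosheaf 𝕜 Ω) {E : Ω} (P : Finpartition E)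
    (x : μ.hat.sumOver P) (F : P.parts) :
    μ.restrictCogerms (P.le F.2) (μ.hat.sumMap P x) = x F := by
  classical
  rw [hat_sumMap]
  refine (map_sum (μ.restrictCogerms (P.le F.2)) _ _).trans ?_
  rw [Finset.sum_eq_single F]
  · exact μ.restrictCogerms_cogermsExt _ _
  · intro F' _ hne
    exact μ.restrictCogerms_cogermsExt_of_disjoint _ _
      (P.disjoint F'.2 F.2 fun h => hne (Subtype.ext h)) _
  · simp

theorem isCosheaf_hat (μ : Precosheaf 𝕜 Ω) : IsCosheaf μ.hat := by
  intro E P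
  refine ⟨⟨fun x y hxy => ?_, fun θ => ?_⟩, fun x => le_antisymm (μ.hat.norm_sumMap_le P x) ?_⟩
  · ext F
    rw [← μ.restrictCogerms_hat_sumMap P x F, ← μ.restrictCogerms_hat_sumMap P y F, hxy]
  -- The sum of the restrictions of `θ` has the same restrictions as `θ`, hence equals `θ`.
  · exact ⟨WithLp.toLp 1 fun F => μ.restrictCogerms (P.le F.2) θ,
      μ.cogerms_ext_of_restrict P fun F hF => μ.restrictCogerms_hat_sumMap P _ ⟨F, hF⟩⟩
  · rw [PiLp.norm_eq_of_L1]
    refine le_trans (Finset.sum_le_sum fun F _ => ?_)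
      (μ.sum_norm_restrictCogerms_le P (μ.hat.sumMap P x))
    rw [μ.restrictCogerms_hat_sumMap P x F]
    exact le_rfl

/-- The component at `P` of a sum of cogerms over the parts of `P`. -/
theorem hat_sumMap_apply_self (μ : Precosheaf 𝕜 Ω) {E : Ω} (P : Finpartition E)
    (x : μ.hat.sumOver P) (G : P.parts) (Q : Finpartition G.1) :
    (show μ.cogerms E from μ.hat.sumMap P x).1 P G =
      μ.sumMap Q ((show μ.cogerms G.1 from x G).1 Q) := by
  classical
  have h1 : (show μ.cogerms E from μ.hat.sumMap P x).1 P = ∑ F : P.parts,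
      μ.push (restr (P.le F.2) P) P ((show μ.cogerms F.1 from x F).1 (restr (P.le F.2) P)) :=
    map_sum (μ.proj E P) (fun F : P.parts => μ.cogermsExt (P.le F.2) (x F)) Finset.univ
  have h2 : ∀ y : P.parts → μ.sumOver P, (∑ F, y F) G = ∑ F, y F G := fun y => by simp
  -- Only the summand `F = G` reaches the component `G`. All parts of its induced partition lie
  -- below `G`, so the transition map there is `sumMap`, whose value on a cogerm does not depend on
  -- the partition.
  rw [h1, h2, Finset.sum_eq_single G, push_apply, μ.sumMap_cogerm _ Q (restr (P.le G.2) P)]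
  · exact Finset.sum_congr rfl fun F _ => dif_pos ((restr (P.le G.2) P).le F.2)
  · intro F _ hne
    rw [push_apply]
    refine Finset.sum_eq_zero fun K _ => dif_neg fun hK => ?_
    exact (restr (P.le F.2) P).ne_bot K.2 (le_bot_iff.1
      (P.disjoint F.2 G.2 (fun h => hne (Subtype.ext h)) ((restr (P.le F.2) P).le K.2) hK))
  · simp

/-! ### The universal property of the space of cogerms -/

/-- The space of cogerms is the limit of the coproducts over finite partitions. -/
def isLimitCogermCone (μ : Precosheaf 𝕜 Ω) (E : Ω) : Limits.IsLimit (μ.cogermCone E) where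
  lift s := ⟨μ.toCogerms E (fun P => (s.π.app P).clm) 1 zero_le_one
      (fun P x => (s.π.app P).clm.le_of_opNorm_le (s.π.app P).norm_le x)
      (fun _ _ h x => congrArg (fun f : Banc.Hom _ _ => f.clm x) (s.w (homOfLE h))),
    μ.norm_toCogerms_le E _ 1 _ _ _⟩
  fac _ _ := rfl
  uniq _ _ hm := Banc.Hom.ext (ContinuousLinearMap.ext fun x => cogerms_ext fun P =>
    congrArg (fun f : Banc.Hom _ _ => f.clm x) (hm P))

/-! ### Linearity of the functor -/

theorem norm_le_of_app {μ ν : Precosheaf 𝕜 Ω} (τ : μ ⟶ ν) {C : ℝ} (hC : 0 ≤ C)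
    (h : ∀ E x, ‖app τ E x‖ ≤ C * ‖x‖) : ‖τ‖ ≤ C :=
  lp.norm_le_of_forall_le hC fun E => ContinuousLinearMap.opNorm_le_bound _ hC (h E)

theorem norm_cogermsMap_le {μ ν : Precosheaf 𝕜 Ω} (τ : μ ⟶ ν) (E : Ω) :
    ‖cogermsMap τ E‖ ≤ ‖τ‖ :=
  ν.norm_toCogerms_le E _ ‖τ‖ _ _ _

theorem norm_hatFunctor_map_le {μ ν : Precosheaf 𝕜 Ω} (τ : μ ⟶ ν) :
    ‖(hatFunctor 𝕜 Ω).map τ‖ ≤ ‖τ‖ :=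
  norm_le_of_app _ (norm_nonneg τ) fun E => (cogermsMap τ E).le_of_opNorm_le (norm_cogermsMap_le τ E)

/-! ### The counit -/

/-- The canonical map `lim_P ∑_{F ∈ P} μ(F) → μ(E)`. -/
def cogermsCounit (μ : Precosheaf 𝕜 Ω) (E : Ω) : μ.cogerms E →L[𝕜] μ.obj E := by
  classical
  exact LinearMap.mkContinuous
    -- The choice of `⊤` is immaterial, by `sumMap_cogerm`.
    { toFun := fun θ => μ.sumMap ⊤ (θ.1 ⊤)
      map_add' := fun θ θ' => μ.sumMap_add ⊤ (θ.1 ⊤) (θ'.1 ⊤)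
      map_smul' := fun c θ => μ.sumMap_smul ⊤ c (θ.1 ⊤) } 1
    (fun θ => by
      rw [one_mul]
      exact (μ.norm_sumMap_le _ _).trans (norm_cogerm_apply_le θ _))

theorem cogermsCounit_apply (μ : Precosheaf 𝕜 Ω) {E : Ω} (θ : μ.cogerms E)
    (P : Finpartition E) : μ.cogermsCounit E θ = μ.sumMap P (θ.1 P) :=
  μ.sumMap_cogerm θ _ P

theorem norm_cogermsCounit_apply_le (μ : Precosheaf 𝕜 Ω) {E : Ω} (θ : μ.cogerms E) :
    ‖μ.cogermsCounit E θ‖ ≤ ‖θ‖ := by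
  classical
  exact (μ.norm_sumMap_le _ _).trans (norm_cogerm_apply_le θ _)

/-- The canonical morphism from the limit precosheaf of `μ` to `μ`. -/
def counit (μ : Precosheaf 𝕜 Ω) : μ.hat ⟶ μ :=
  natTrans.mk' (μ := μ.hat) (ν := μ) (fun E => μ.cogermsCounit E) 1
    (fun _ => ContinuousLinearMap.opNorm_le_bound _ zero_le_one fun θ => by
      rw [one_mul]
      exact μ.norm_cogermsCounit_apply_le θ)
    (fun E F h (θ : μ.cogerms E) => by
      classical
      refine (μ.cogermsCounit_apply (μ.cogermsExt h θ) ⊤).trans ?_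
      rw [cogermsExt_apply, μ.sumMap_push h (restr_refines h _), ← cogermsCounit_apply]
      rfl)

theorem app_counit (μ : Precosheaf 𝕜 Ω) {E : Ω} (θ : μ.cogerms E) (P : Finpartition E) :
    app (μ := μ.hat) μ.counit E θ = μ.sumMap P (θ.1 P) :=
  μ.cogermsCounit_apply θ P

/-! ### Transposition -/

/-- For a cosheaf, the isometric isomorphism `∑_{F ∈ P} ν(F) ≃ ν(E)`. -/
def IsCosheaf.sumEquiv {ν : Precosheaf 𝕜 Ω} (hν : IsCosheaf ν) {E : Ω} (P : Finpartition E) :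
    ν.sumOver P ≃ₗᵢ[𝕜] ν.obj E where
  toLinearEquiv := LinearEquiv.ofBijective
    { toFun := ν.sumMap P
      map_add' := ν.sumMap_add P
      map_smul' := ν.sumMap_smul P } (hν E P).1
  norm_map' := (hν E P).2

theorem IsCosheaf.sumMap_sumEquiv_symm {ν : Precosheaf 𝕜 Ω} (hν : IsCosheaf ν) {E : Ω}
    (P : Finpartition E) (x : ν.obj E) : ν.sumMap P ((hν.sumEquiv P).symm x) = x :=
  (hν.sumEquiv P).apply_symm_apply x

/-- This is `sumMap_push` read through the inverses of `ε_P` and `ε_Q`. With `E = E'` it gives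
compatibility of the lifted family, and in general its naturality. -/
theorem IsCosheaf.push_sumEquiv_symm {ν : Precosheaf 𝕜 Ω} (hν : IsCosheaf ν) {E E' : Ω}
    (h : E ≤ E') {P : Finpartition E} {Q : Finpartition E'} (hPQ : Refines P Q) (x : ν.obj E) :
    ν.push P Q ((hν.sumEquiv P).symm x) = (hν.sumEquiv Q).symm (ν.ext h x) := by
  refine (hν E' Q).1.1 ?_
  rw [ν.sumMap_push h hPQ, hν.sumMap_sumEquiv_symm, hν.sumMap_sumEquiv_symm]

theorem norm_sumOverMap_apply_le {μ ν : Precosheaf 𝕜 Ω} (τ : μ ⟶ ν) {E : Ω}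
    (P : Finpartition E) (x : μ.sumOver P) : ‖sumOverMap τ P x‖ ≤ ‖τ‖ * ‖x‖ :=
  (sumOverMap τ P).le_of_opNorm_le (LinearMap.mkContinuous_norm_le _ (norm_nonneg _) _) x

/-- The component at `E` of the transpose of a morphism from a cosheaf to a precosheaf. -/
def cogermsTranspose {ν μ : Precosheaf 𝕜 Ω} (hν : IsCosheaf ν) (τ : ν ⟶ μ) (E : Ω) :
    ν.obj E →L[𝕜] μ.cogerms E :=
  μ.toCogerms E (fun P => (sumOverMap τ P).comp
      (hν.sumEquiv P).symm.toContinuousLinearEquiv.toContinuousLinearMap) ‖τ‖ (norm_nonneg _)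
    (fun P x => (norm_sumOverMap_apply_le τ P _).trans_eq
      (congrArg (‖τ‖ * ·) ((hν.sumEquiv P).symm.norm_map x)))
    (fun P Q h x => by
      change μ.push P Q (sumOverMap τ P ((hν.sumEquiv P).symm x)) =
        sumOverMap τ Q ((hν.sumEquiv Q).symm x)
      rw [push_sumOverMap, hν.push_sumEquiv_symm le_rfl fun _ hF => h hF, ext_self])

theorem cogermsTranspose_apply {ν μ : Precosheaf 𝕜 Ω} (hν : IsCosheaf ν) (τ : ν ⟶ μ) {E : Ω}
    (x : ν.obj E) (P : Finpartition E) :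
    (cogermsTranspose hν τ E x).1 P = sumOverMap τ P ((hν.sumEquiv P).symm x) := rfl

theorem norm_cogermsTranspose_le {ν μ : Precosheaf 𝕜 Ω} (hν : IsCosheaf ν) (τ : ν ⟶ μ) (E : Ω) :
    ‖cogermsTranspose hν τ E‖ ≤ ‖τ‖ :=
  μ.norm_toCogerms_le E _ ‖τ‖ _ _ _

/-- The transpose of a morphism from a cosheaf to a precosheaf. -/
def transpose {ν μ : Precosheaf 𝕜 Ω} (hν : IsCosheaf ν) (τ : ν ⟶ μ) : ν ⟶ μ.hat :=
  natTrans.mk' (μ := ν) (ν := μ.hat) (fun E => cogermsTranspose hν τ E) ‖τ‖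
    (norm_cogermsTranspose_le hν τ)
    (fun E F h x => cogerms_ext fun P => by
      refine Eq.trans ?_ (push_sumOverMap τ (restr h P) P _).symm
      exact (congrArg (sumOverMap τ P)
        (hν.push_sumEquiv_symm h (restr_refines h P) x)).symm)

theorem norm_transpose_le {ν μ : Precosheaf 𝕜 Ω} (hν : IsCosheaf ν) (τ : ν ⟶ μ) :
    ‖transpose hν τ‖ ≤ ‖τ‖ :=
  norm_le_of_app _ (norm_nonneg τ) fun E =>
    (cogermsTranspose hν τ E).le_of_opNorm_le (norm_cogermsTranspose_le hν τ E)

theorem transpose_comp {ν μ μ' : Precosheaf 𝕜 Ω} (hν : IsCosheaf ν) (τ : ν ⟶ μ) (g : μ ⟶ μ') :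
    transpose hν (τ ≫ g) = (show ν ⟶ μ'.hat from transpose hν τ ≫ (hatFunctor 𝕜 Ω).map g) :=
  hom_ext fun _ _ => rfl

theorem transpose_counit {ν μ : Precosheaf 𝕜 Ω} (hν : IsCosheaf ν) (τ : ν ⟶ μ) :
    transpose hν τ ≫ μ.counit = τ := by
  classical
  refine hom_ext fun E x => ?_
  refine (μ.cogermsCounit_apply (cogermsTranspose hν τ E x) ⊤).trans ?_
  rw [cogermsTranspose_apply, sumMap_sumOverMap, hν.sumMap_sumEquiv_symm]

/-- Uniqueness of lifts. Writing `x = ε_P y`, naturality turns `σ x` into the sum of the extended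
cogerms `σ (y G)`, and the component of that sum at `P` is given by their counits. -/
theorem transpose_comp_counit {ν μ : Precosheaf 𝕜 Ω} (hν : IsCosheaf ν) (σ : ν ⟶ μ.hat) :
    transpose hν (σ ≫ μ.counit) = σ := by
  classical
  refine hom_ext fun E x => cogerms_ext fun P => ?_
  obtain ⟨y, rfl⟩ := (hν.sumEquiv P).surjective x
  refine (cogermsTranspose_apply hν (σ ≫ μ.counit) (hν.sumEquiv P y) P).trans ?_
  rw [LinearIsometryEquiv.symm_apply_apply]
  have h : app σ E (hν.sumEquiv P y) = μ.hat.sumMap P (sumOverMap σ P y) :=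
    (sumMap_sumOverMap σ P y).symm
  rw [h]
  ext G
  exact (μ.hat_sumMap_apply_self P (sumOverMap σ P y) G ⊤).symm

theorem norm_comp_counit_le {ν μ : Precosheaf 𝕜 Ω} (σ : ν ⟶ μ.hat) :
    ‖σ ≫ μ.counit‖ ≤ ‖σ‖ :=
  norm_le_of_app _ (norm_nonneg σ) fun E x =>
    (μ.norm_cogermsCounit_apply_le (app σ E x)).trans (norm_app_apply_le σ E x)

/-- Composition with the counit, as an isometric isomorphism. -/
def transposeEquiv {ν : Precosheaf 𝕜 Ω} (hν : IsCosheaf ν) (μ : Precosheaf 𝕜 Ω) :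
    (ν ⟶ μ.hat) ≃ₗᵢ[𝕜] (ν ⟶ μ) where
  toFun σ := σ ≫ μ.counit
  invFun τ := transpose hν τ
  left_inv := transpose_comp_counit hν
  right_inv := transpose_counit hν
  map_add' σ σ' := hom_ext fun E x => map_add (μ.cogermsCounit E) (app σ E x) (app σ' E x)
  map_smul' c σ := hom_ext fun E x => map_smul (μ.cogermsCounit E) c (app σ E x)
  -- Both the map and its inverse are contractive.
  norm_map' σ := le_antisymm (norm_comp_counit_le σ)
    ((congrArg norm (transpose_comp_counit hν σ)).symm.trans_le (norm_transpose_le hν _))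

/-! ### The adjunction -/

/-- The functor `μ ↦ lim_P ∑_{F ∈ P} μ(F)` is right adjoint to the inclusion of cosheaves into
precosheaves. -/
def cosheafAdjunction (𝕜 : Type v) [RCLike 𝕜] (Ω : Type u) [BooleanAlgebra Ω] :
    (IsCosheaf (𝕜 := 𝕜) (Ω := Ω)).ι ⊣ IsCosheaf.lift (hatFunctor 𝕜 Ω) isCosheaf_hat :=
  Adjunction.mkOfHomEquiv
    { homEquiv := fun ν μ =>
        { toFun := fun τ => ObjectProperty.homMk (transpose ν.property τ)
          invFun := fun σ => σ.hom ≫ μ.counit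
          left_inv := fun τ => transpose_counit ν.property τ
          right_inv := fun σ => ObjectProperty.hom_ext _ (transpose_comp_counit ν.property σ.hom) }
      -- Since the inverse bijection is composition with the counit, naturality in the cosheaf is
      -- associativity.
      homEquiv_naturality_left_symm := fun f g => Category.assoc f.hom g.hom (counit _)
      homEquiv_naturality_right := fun {ν _ _} τ g => ObjectProperty.hom_ext _ <|
        transpose_comp ν.property τ g }

end

end Precosheaf

end Cosheafification

open Cosheafification Cosheafification.Precosheaf in
theorem mainTheorem6 (𝕜 : Type v) [RCLike 𝕜] (Ω : Type u) [BooleanAlgebra Ω] :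
    -- the space of cogerms over `E` is the limit of `P ↦ ∑_{F ∈ P} μ(F)`
    (∀ (μ : Precosheaf 𝕜 Ω) (E : Ω), Nonempty (Limits.IsLimit (μ.cogermCone E))) ∧
    -- the functor is linear and contractive on spaces of morphisms
    (∀ (μ ν : Precosheaf 𝕜 Ω),
      (∀ σ τ : μ ⟶ ν, (hatFunctor 𝕜 Ω).map (σ + τ) =
        (hatFunctor 𝕜 Ω).map σ + (hatFunctor 𝕜 Ω).map τ) ∧
      (∀ (c : 𝕜) (τ : μ ⟶ ν), (hatFunctor 𝕜 Ω).map (c • τ) = c • (hatFunctor 𝕜 Ω).map τ) ∧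
      (∀ τ : μ ⟶ ν, ‖(hatFunctor 𝕜 Ω).map τ‖ ≤ ‖τ‖)) ∧
    -- it takes values in cosheaves, and is right adjoint to the inclusion of cosheaves
    ∃ (h : ∀ μ : Precosheaf 𝕜 Ω, IsCosheaf ((hatFunctor 𝕜 Ω).obj μ))
      (adj : (IsCosheaf (𝕜 := 𝕜) (Ω := Ω)).ι ⊣ IsCosheaf.lift (hatFunctor 𝕜 Ω) h),
      -- the counit is the canonical map `lim_P ∑_{F ∈ P} μ(F) → μ(E)`
      (∀ (μ : Precosheaf 𝕜 Ω) (E : Ω) (θ : μ.cogerms E) (P : Finpartition E),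
        app (μ := μ.hat) (adj.counit.app μ) E θ = μ.sumMap P (θ.1 P)) ∧
      -- the bijections of the adjunction are linear isometries, so the adjunction is enriched
      ∀ (ν : (IsCosheaf (𝕜 := 𝕜) (Ω := Ω)).FullSubcategory) (μ : Precosheaf 𝕜 Ω),
        ∃ Φ : (ν.obj ⟶ μ) ≃ₗᵢ[𝕜] (ν.obj ⟶ (hatFunctor 𝕜 Ω).obj μ),
          ∀ τ : ν.obj ⟶ μ, Φ τ = (adj.homEquiv ν μ τ).hom := by
  refine ⟨fun μ E => ⟨μ.isLimitCogermCone E⟩, fun μ ν => ⟨fun σ τ => ?_, fun c τ => ?_,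
    norm_hatFunctor_map_le⟩, isCosheaf_hat, cosheafAdjunction 𝕜 Ω, fun μ E θ P => ?_,
    fun ν μ => ⟨(transposeEquiv ν.property μ).symm, fun τ => ?_⟩⟩
  · exact hom_ext fun E x => rfl
  · exact hom_ext fun E x => rfl
  · refine Eq.trans ?_ (μ.app_counit θ P)
    simp only [cosheafAdjunction, Adjunction.mkOfHomEquiv_counit_app]
    rfl
  · simp only [cosheafAdjunction, Adjunction.mkOfHomEquiv_homEquiv]
    rfl
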